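/- Let $\mathbb{H}$ be the algebra of real quaternions, $\ell\ge 0$ an integer, and let $H_{\mathbb{H}}=(\mathbb{H}^*)^{\ell+1}\subset GL_{\ell+1}(\mathbb{H})$ be the subgroup of invertible diagonal matrices. Define the quaternionic Weyl group $W_{GL_{\ell+1}}(\mathbb{H})$ to be the group of those automorphisms of $H_{\mathbb{H}}$ that are induced by inner automorphisms of $GL_{\ell+1}(\mathbb{H})$, i.e. of the form $h\mapsto ghg^{-1}$ with $g\in GL_{\ell+1}(\mathbb{H})$, $gH_{\mathbb{H}}g^{-1}=H_{\mathbb{H}}$. Then there is a group isomorphism $$W_{GL_{\ell+1}}(\mathbb{H})\;\simeq\;\mathfrak{S}_{\ell+1}\ltimes (SO_3)^{\ell+1},$$ where $SO_3=SO_3(\mathbb{R})$ and $\mathfrak{S}_{\ell+1}$ acts on $(SO_3)^{\ell+1}$ by permuting the factors, $(\sigma\cdot R)_i=R_{\sigma^{-1}(i)}$. More precisely, it can be chosen so that the element $w\in W_{GL_{\ell+1}}(\mathbb{H})$ corresponding to $(R,\sigma)$, with $R=(R_1,\dots,R_{\ell+1})\in(SO_3)^{\ell+1}$ and $\sigma\in\mathfrak{S}_{\ell+1}$,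 acts on $H_{\mathbb{H}}$ by $$\bigl(w(h)\bigr)_i=R_i\cdot h_{\sigma^{-1}(i)},\qquad h=\mathrm{diag}(h_1,\dots,h_{\ell+1}),\quad 1\le i\le \ell+1,$$ where $SO_3$ acts on $\mathbb{H}=\mathbb{R}\oplus(\mathbb{R}i\oplus\mathbb{R}j\oplus\mathbb{R}k)$ trivially on the real part and by the standard rotations of the space $\mathbb{R}^3$ of purely imaginary quaternions. -/

import Mathlib

open scoped Quaternion Matrix

/-- The homomorphism `(Aˣ)ⁿ → GLₙ(A)` sending `(d₁, …, dₙ)` to `diag(d₁, …, dₙ)`. -/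
def diagonalGL (n : ℕ) (A : Type*) [DivisionRing A] :
    (Fin n → Aˣ) →* Matrix.GeneralLinearGroup (Fin n) A :=
  (Units.map (Matrix.diagonalRingHom (Fin n) A).toMonoidHom).comp
    MulEquiv.piUnits.symm.toMonoidHom

/-- The diagonal subgroup `H_A = (Aˣ)ⁿ` of `GLₙ(A)`. -/
def diagonalSubgroup (n : ℕ) (A : Type*) [DivisionRing A] :
    Subgroup (Matrix.GeneralLinearGroup (Fin n) A) :=
  (diagonalGL n A).range

/-- The Weyl group of `GLₙ(A)`: the group of those automorphisms of the diagonal subgroup `H_A`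
that are induced by inner automorphisms of `GLₙ(A)`, i.e. that are of the form
`h ↦ g * h * g⁻¹` with `g ∈ GLₙ(A)` normalizing `H_A`. -/
def weylGroupGL (n : ℕ) (A : Type*) [DivisionRing A] :
    Subgroup (MulAut (diagonalSubgroup n A)) :=
  (diagonalSubgroup n A).normalizerMonoidHom.range

/-- The action of a real `3 × 3` matrix on quaternions: it fixes the real part and acts on the
imaginary part `x₁ i + x₂ j + x₃ k` by multiplying the column `(x₁, x₂, x₃)`. -/
def rotateIm (R : Matrix (Fin 3) (Fin 3) ℝ) (q : ℍ[ℝ]) : ℍ[ℝ] :=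
  ⟨q.re, (R *ᵥ ![q.imI, q.imJ, q.imK]) 0, (R *ᵥ ![q.imI, q.imJ, q.imK]) 1,
    (R *ᵥ ![q.imI, q.imJ, q.imK]) 2⟩

/-! A matrix normalizing the diagonal subgroup is monomial (`exists_perm_conj_of_mem_normalizer`),
so it acts by a permutation and by conjugation with a nonzero quaternion in each slot. These
conjugations are exactly the rotations of the imaginary part: `exists_rotateIm_eq_conj` uses the
explicit Euler-Rodrigues matrix, and `exists_conj_eq_rotateIm` a Skolem-Noether averaging argument.
The relation `ActsAs` respects products and pairs each Weyl group element with exactly one element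
of the semidirect product, and conversely; it is therefore the graph of the isomorphism. -/

namespace WeylQuaternion

/-! ### Rotations of the imaginary quaternions as conjugations -/

section Rotation

@[simp]
theorem re_rotateIm (R : Matrix (Fin 3) (Fin 3) ℝ) (q : ℍ[ℝ]) : (rotateIm R q).re = q.re := rfl

@[simp]
theorem imI_rotateIm (R : Matrix (Fin 3) (Fin 3) ℝ) (q : ℍ[ℝ]) :
    (rotateIm R q).imI = R 0 0 * q.imI + R 0 1 * q.imJ + R 0 2 * q.imK := by
  simp [rotateIm, Matrix.mulVec, dotProduct, Fin.sum_univ_three]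

@[simp]
theorem imJ_rotateIm (R : Matrix (Fin 3) (Fin 3) ℝ) (q : ℍ[ℝ]) :
    (rotateIm R q).imJ = R 1 0 * q.imI + R 1 1 * q.imJ + R 1 2 * q.imK := by
  simp [rotateIm, Matrix.mulVec, dotProduct, Fin.sum_univ_three]

@[simp]
theorem imK_rotateIm (R : Matrix (Fin 3) (Fin 3) ℝ) (q : ℍ[ℝ]) :
    (rotateIm R q).imK = R 2 0 * q.imI + R 2 1 * q.imJ + R 2 2 * q.imK := by
  simp [rotateIm, Matrix.mulVec, dotProduct, Fin.sum_univ_three]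

theorem rotateIm_mul (R S : Matrix (Fin 3) (Fin 3) ℝ) (q : ℍ[ℝ]) :
    rotateIm (R * S) q = rotateIm R (rotateIm S q) := by
  ext <;> simp [Matrix.mul_apply, Fin.sum_univ_three] <;> ring

/-- The quaternion `i`. -/
@[simps]
def unitI : ℍ[ℝ] := ⟨0, 1, 0, 0⟩

/-- The quaternion `j`. -/
@[simps]
def unitJ : ℍ[ℝ] := ⟨0, 0, 1, 0⟩

/-- The quaternion `k`. -/
@[simps]
def unitK : ℍ[ℝ] := ⟨0, 0, 0, 1⟩

theorem unitI_mul_unitI : unitI * unitI = -1 := by ext <;> simp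

theorem unitJ_mul_unitJ : unitJ * unitJ = -1 := by ext <;> simp

theorem unitK_mul_unitK : unitK * unitK = -1 := by ext <;> simp

theorem unitI_mul_unitJ : unitI * unitJ = unitK := by ext <;> simp

theorem unitJ_mul_unitI : unitJ * unitI = -unitK := by ext <;> simp

theorem unitJ_mul_unitK : unitJ * unitK = unitI := by ext <;> simp

theorem unitK_mul_unitJ : unitK * unitJ = -unitI := by ext <;> simp

theorem unitK_mul_unitI : unitK * unitI = unitJ := by ext <;> simp

theorem unitI_mul_unitK : unitI * unitK = -unitJ := by ext <;> simp

theorem eq_basis_combination (x : ℍ[ℝ]) :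
    x = x.re • 1 + x.imI • unitI + x.imJ • unitJ + x.imK • unitK := by
  ext <;> simp

theorem rotateIm_eq_basis_combination (R : Matrix (Fin 3) (Fin 3) ℝ) (x : ℍ[ℝ]) :
    rotateIm R x = x.re • 1 + x.imI • rotateIm R unitI + x.imJ • rotateIm R unitJ +
      x.imK • rotateIm R unitK := by
  ext <;> simp <;> ring

theorem rotateIm_neg_one (R : Matrix (Fin 3) (Fin 3) ℝ) : rotateIm R (-1) = -1 := by
  ext <;> simp

theorem rotateIm_neg (R : Matrix (Fin 3) (Fin 3) ℝ) (x : ℍ[ℝ]) :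
    rotateIm R (-x) = -rotateIm R x := by
  ext <;> simp <;> ring

/-- A matrix is determined by its action on imaginary quaternions that are units. -/
theorem matrix_ext_of_rotateIm {R S : Matrix (Fin 3) (Fin 3) ℝ}
    (h : ∀ u : ℍ[ℝ]ˣ, rotateIm R u = rotateIm S u) : R = S := by
  have key : ∀ q : ℍ[ℝ], q ≠ 0 → rotateIm R q = rotateIm S q := fun q hq => h (Units.mk0 q hq)
  have hi := key unitI (fun h => by simpa using congrArg (·.imI) h)
  have hj := key unitJ (fun h => by simpa using congrArg (·.imJ) h)
  have hk := key unitK (fun h => by simpa using congrArg (·.imK) h)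
  simp [Quaternion.ext_iff] at hi hj hk
  ext a b
  fin_cases a <;> fin_cases b <;> simp [hi, hj, hk]

/-- `‖q‖²` times the matrix of conjugation by `q` on imaginary quaternions. -/
def conjMatrix (q : ℍ[ℝ]) : Matrix (Fin 3) (Fin 3) ℝ :=
  !![q.re ^ 2 + q.imI ^ 2 - q.imJ ^ 2 - q.imK ^ 2, 2 * (q.imI * q.imJ - q.re * q.imK),
      2 * (q.imI * q.imK + q.re * q.imJ);
    2 * (q.imI * q.imJ + q.re * q.imK), q.re ^ 2 - q.imI ^ 2 + q.imJ ^ 2 - q.imK ^ 2,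
      2 * (q.imJ * q.imK - q.re * q.imI);
    2 * (q.imI * q.imK - q.re * q.imJ), 2 * (q.imJ * q.imK + q.re * q.imI),
      q.re ^ 2 - q.imI ^ 2 - q.imJ ^ 2 + q.imK ^ 2]

theorem conjMatrix_mul_transpose (q : ℍ[ℝ]) :
    conjMatrix q * (conjMatrix q)ᵀ = (Quaternion.normSq q ^ 2) • 1 := by
  ext a b
  fin_cases a <;> fin_cases b <;>
    simp [conjMatrix, Matrix.mul_apply, Fin.sum_univ_three, Quaternion.normSq_def'] <;> ring

theorem det_conjMatrix (q : ℍ[ℝ]) : (conjMatrix q).det = Quaternion.normSq q ^ 3 := by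
  simp [conjMatrix, Matrix.det_fin_three, Quaternion.normSq_def']
  ring

theorem rotateIm_conjMatrix (q x : ℍ[ℝ]) (hq : q ≠ 0) :
    rotateIm ((Quaternion.normSq q)⁻¹ • conjMatrix q) x * q = q * x := by
  have hn : Quaternion.normSq q ≠ 0 := Quaternion.normSq_ne_zero.mpr hq
  have hs : (Quaternion.normSq q)⁻¹ * (q.re ^ 2 + q.imI ^ 2 + q.imJ ^ 2 + q.imK ^ 2) = 1 := by
    rw [← Quaternion.normSq_def']; exact inv_mul_cancel₀ hn
  generalize (Quaternion.normSq q)⁻¹ = s at hs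
  ext <;> simp [conjMatrix]
  · linear_combination (-q.imI * x.imI - q.imJ * x.imJ - q.imK * x.imK) * hs
  · linear_combination (q.re * x.imI + q.imJ * x.imK - q.imK * x.imJ) * hs
  · linear_combination (q.re * x.imJ + q.imK * x.imI - q.imI * x.imK) * hs
  · linear_combination (q.re * x.imK + q.imI * x.imJ - q.imJ * x.imI) * hs

/-- Conjugation by a nonzero quaternion is a rotation. -/
theorem exists_rotateIm_eq_conj (u : ℍ[ℝ]ˣ) :
    ∃ R : Matrix.specialOrthogonalGroup (Fin 3) ℝ, ∀ x : ℍ[ℝ],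
      rotateIm R.val x = u * x * ((u⁻¹ : ℍ[ℝ]ˣ) : ℍ[ℝ]) := by
  have hn : Quaternion.normSq (u : ℍ[ℝ]) ≠ 0 := Quaternion.normSq_ne_zero.mpr u.ne_zero
  refine ⟨⟨(Quaternion.normSq (u : ℍ[ℝ]))⁻¹ • conjMatrix u, ?_⟩, fun x => ?_⟩
  · rw [Matrix.mem_specialOrthogonalGroup_iff, Matrix.mem_orthogonalGroup_iff]
    constructor
    · rw [Matrix.transpose_smul, Matrix.smul_mul, Matrix.mul_smul, conjMatrix_mul_transpose,
        smul_smul, smul_smul]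
      convert one_smul ℝ _
      field_simp
    · rw [Matrix.det_smul, det_conjMatrix]
      simp [hn]
  · rw [Units.eq_mul_inv_iff_mul_eq]
    exact rotateIm_conjMatrix _ _ u.ne_zero

/-- A rotation of the imaginary quaternions is multiplicative. -/
theorem rotateIm_map_mul (R : Matrix.specialOrthogonalGroup (Fin 3) ℝ) (x y : ℍ[ℝ]) :
    rotateIm R.val (x * y) = rotateIm R.val x * rotateIm R.val y := by
  obtain ⟨R, hR⟩ := R
  rw [Matrix.mem_specialOrthogonalGroup_iff, Matrix.mem_orthogonalGroup_iff'] at hR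
  obtain ⟨ho, hd⟩ := hR
  -- The relations `ho` say that dot products are preserved, which gives the real part of the
  -- product; adjugate equal to transpose says that cross products are preserved, which gives the
  -- imaginary part.
  have hadj : R.adjugate = Rᵀ := by
    calc R.adjugate = (Rᵀ * R) * R.adjugate := by rw [ho, one_mul]
      _ = Rᵀ := by rw [mul_assoc, Matrix.mul_adjugate, hd, one_smul, mul_one]
  have ha := fun a b => congrFun (congrFun hadj a) b
  have hb := fun a b => congrFun (congrFun ho a) b
  simp only [Matrix.adjugate_fin_three, Matrix.mul_apply, Fin.sum_univ_three,
    Matrix.transpose_apply] at ha hb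
  have a00 := ha 0 0
  have a01 := ha 0 1
  have a02 := ha 0 2
  have a10 := ha 1 0
  have a11 := ha 1 1
  have a12 := ha 1 2
  have a20 := ha 2 0
  have a21 := ha 2 1
  have a22 := ha 2 2
  have b00 := hb 0 0
  have b01 := hb 0 1
  have b02 := hb 0 2
  have b11 := hb 1 1
  have b12 := hb 1 2
  have b22 := hb 2 2
  simp at a00 a01 a02 a10 a11 a12 a20 a21 a22 b00 b01 b02 b11 b12 b22
  ext <;> simp
  · linear_combination x.imI * y.imI * b00 + x.imJ * y.imJ * b11 + x.imK * y.imK * b22 +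
      (x.imI * y.imJ + x.imJ * y.imI) * b01 + (x.imI * y.imK + x.imK * y.imI) * b02 +
      (x.imJ * y.imK + x.imK * y.imJ) * b12
  · linear_combination -(x.imJ * y.imK - x.imK * y.imJ) * a00 -
      (x.imK * y.imI - x.imI * y.imK) * a10 - (x.imI * y.imJ - x.imJ * y.imI) * a20
  · linear_combination -(x.imJ * y.imK - x.imK * y.imJ) * a01 -
      (x.imK * y.imI - x.imI * y.imK) * a11 - (x.imI * y.imJ - x.imJ * y.imI) * a21
  · linear_combination -(x.imJ * y.imK - x.imK * y.imJ) * a02 -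
      (x.imK * y.imI - x.imI * y.imK) * a12 - (x.imI * y.imJ - x.imJ * y.imI) * a22

/-- Averaging `a` over the basis `1, i, j, k`, twisted by the rotation `R`. -/
noncomputable def twistedAverage (R : Matrix (Fin 3) (Fin 3) ℝ) (a : ℍ[ℝ]) : ℍ[ℝ] :=
  a - rotateIm R unitI * a * unitI - rotateIm R unitJ * a * unitJ -
    rotateIm R unitK * a * unitK

/-- With φ the rotation, the average is the sum of φ(e) a e⁻¹ over e = 1, i, j, k. For x = i, j, k,
the map e ↦ xe permutes the basis up to signs, which cancel, so φ(x) passes through as x; linearity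
does the rest. -/
theorem rotateIm_mul_twistedAverage (R : Matrix.specialOrthogonalGroup (Fin 3) ℝ) (a x : ℍ[ℝ]) :
    rotateIm R.val x * twistedAverage R.val a = twistedAverage R.val a * x := by
  have hm := rotateIm_map_mul R
  have h1 := rotateIm_neg_one R.val
  have hn := rotateIm_neg R.val
  have hii := hm unitI unitI
  have hjj := hm unitJ unitJ
  have hkk := hm unitK unitK
  have hij := hm unitI unitJ
  have hji := hm unitJ unitI
  have hjk := hm unitJ unitK
  have hkj := hm unitK unitJ
  have hki := hm unitK unitI
  have hik := hm unitI unitK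
  simp only [unitI_mul_unitI, unitJ_mul_unitJ, unitK_mul_unitK, unitI_mul_unitJ, unitJ_mul_unitI,
    unitJ_mul_unitK, unitK_mul_unitJ, unitK_mul_unitI, unitI_mul_unitK, h1, hn]
    at hii hjj hkk hij hji hjk hkj hki hik
  rw [rotateIm_eq_basis_combination R.val x]
  conv_rhs => rw [eq_basis_combination x]
  unfold twistedAverage
  generalize rotateIm R.val unitI = p at *
  generalize rotateIm R.val unitJ = q at *
  generalize rotateIm R.val unitK = r at *
  simp only [add_mul, mul_add, smul_mul_assoc, mul_smul_comm, one_mul, mul_one]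
  refine congrArg₂ _ (congrArg₂ _ (congrArg₂ _ rfl (congrArg _ ?_)) (congrArg _ ?_)) (congrArg _ ?_)
  · simp only [mul_sub, sub_mul, ← mul_assoc, ← hii, ← hij, ← hik]
    simp only [mul_assoc, unitI_mul_unitI, unitJ_mul_unitI, unitK_mul_unitI, mul_neg, neg_mul,
      mul_one, one_mul]
    abel
  · simp only [mul_sub, sub_mul, ← mul_assoc, ← hji, ← hjj, ← hjk]
    simp only [mul_assoc, unitI_mul_unitJ, unitJ_mul_unitJ, unitK_mul_unitJ, mul_neg, neg_mul,
      mul_one, one_mul]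
    abel
  · simp only [mul_sub, sub_mul, ← mul_assoc, ← hki, ← hkj, ← hkk]
    simp only [mul_assoc, unitI_mul_unitK, unitJ_mul_unitK, unitK_mul_unitK, mul_neg, neg_mul,
      mul_one, one_mul]
    abel

/-- Averaging once more, over a = f with right factor f⁻¹, produces the sums of f e⁻¹ f⁻¹ over f.
These vanish for imaginary e and equal 4 for e = 1, so not all averages are zero. -/
theorem exists_twistedAverage_ne_zero (R : Matrix (Fin 3) (Fin 3) ℝ) :
    ∃ a, twistedAverage R a ≠ 0 := by
  by_contra! h
  have key : twistedAverage R 1 - twistedAverage R unitI * unitI -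
      twistedAverage R unitJ * unitJ -
      twistedAverage R unitK * unitK = ((4 : ℝ) : ℍ[ℝ]) := by
    unfold twistedAverage
    generalize rotateIm R unitI = p
    generalize rotateIm R unitJ = q
    generalize rotateIm R unitK = r
    ext <;> simp <;> ring
  simpa [h] using congrArg (·.re) key

/-- Every rotation of the imaginary quaternions is conjugation by a nonzero quaternion. -/
theorem exists_conj_eq_rotateIm (R : Matrix.specialOrthogonalGroup (Fin 3) ℝ) :
    ∃ u : ℍ[ℝ]ˣ, ∀ x : ℍ[ℝ], rotateIm R.val x = u * x * ((u⁻¹ : ℍ[ℝ]ˣ) : ℍ[ℝ]) := by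
  obtain ⟨a, ha⟩ := exists_twistedAverage_ne_zero R.val
  refine ⟨Units.mk0 _ ha, fun x => ?_⟩
  rw [Units.eq_mul_inv_iff_mul_eq]
  exact rotateIm_mul_twistedAverage R a x

end Rotation

/-! ### Monomial matrices and the normalizer of the diagonal subgroup -/

section Monomial

variable {n : ℕ} {A : Type*} [DivisionRing A]

theorem diagonalGL_val (d : Fin n → Aˣ) :
    (diagonalGL n A d).val = Matrix.diagonal fun i => (d i : A) := rfl

/-- The monomial matrix with entry `u i` at `(i, σ⁻¹ i)`. -/
def monomialGL (u : Fin n → Aˣ) (σ : Equiv.Perm (Fin n)) :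
    Matrix.GeneralLinearGroup (Fin n) A where
  val := Matrix.of fun i j => if σ⁻¹ i = j then (u i : A) else 0
  inv := Matrix.of fun j i => if σ⁻¹ i = j then ((u i)⁻¹ : A) else 0
  val_inv := by
    ext i k
    by_cases h : i = k <;> simp [Matrix.mul_apply, Matrix.one_apply, h, eq_comm]
  inv_val := by
    ext j k
    simp only [Matrix.mul_apply, Matrix.one_apply, Matrix.of_apply]
    rw [Finset.sum_eq_single (σ j)]
    · by_cases h : j = k <;> simp [h]
    · intro b _ hb
      rw [if_neg, zero_mul]
      rintro rfl
      simp at hb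
    · simp

theorem monomialGL_mul_diagonalGL (u d : Fin n → Aˣ) (σ : Equiv.Perm (Fin n)) :
    monomialGL u σ * diagonalGL n A d =
      diagonalGL n A (fun i => u i * d (σ⁻¹ i) * (u i)⁻¹) * monomialGL u σ := by
  apply Units.ext
  ext i j
  simp only [Units.val_mul, diagonalGL_val, Matrix.mul_diagonal, Matrix.diagonal_mul]
  by_cases h : σ⁻¹ i = j
  · subst h
    simp [monomialGL, mul_assoc]
  · have : σ.symm i ≠ j := h
    simp [monomialGL, this]

theorem monomialGL_mem_normalizer (u : Fin n → Aˣ) (σ : Equiv.Perm (Fin n)) :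
    monomialGL u σ ∈ Subgroup.normalizer (diagonalSubgroup n A : Set _) := by
  rw [Subgroup.mem_normalizer_iff]
  intro h
  constructor
  · rintro ⟨d, rfl⟩
    exact ⟨_, (mul_inv_eq_of_eq_mul (monomialGL_mul_diagonalGL u d σ)).symm⟩
  · rintro ⟨d, hd⟩
    refine ⟨fun j => (u (σ j))⁻¹ * d (σ j) * u (σ j), ?_⟩
    apply mul_left_cancel (a := monomialGL u σ)
    rw [monomialGL_mul_diagonalGL, ← eq_mul_inv_iff_mul_eq, ← hd]
    congr 1
    ext i
    simp [mul_assoc]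

/-- A matrix normalizing the diagonal subgroup acts on it by a permutation and conjugations. -/
theorem exists_perm_conj_of_mem_normalizer [NeZero (2 : A)]
    {g : Matrix.GeneralLinearGroup (Fin n) A} (hg : g ∈ Subgroup.normalizer (diagonalSubgroup n A : Set _)) :
    ∃ (u : Fin n → Aˣ) (σ : Equiv.Perm (Fin n)), ∀ d : Fin n → Aˣ,
      g * diagonalGL n A d * g⁻¹ = diagonalGL n A fun i => u i * d (σ⁻¹ i) * (u i)⁻¹ := by
  have hconj : ∀ d : Fin n → Aˣ, ∃ e : Fin n → Aˣ,
      g * diagonalGL n A d * g⁻¹ = diagonalGL n A e ∧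
        ∀ i j, g.val i j * d j = e i * g.val i j := by
    intro d
    obtain ⟨e, he⟩ := (Subgroup.mem_normalizer_iff.mp hg _).mp ⟨d, rfl⟩
    refine ⟨e, he.symm, fun i j => ?_⟩
    have := congrArg (fun m => m.val i j) (mul_inv_eq_iff_eq_mul.mp he.symm)
    simpa only [Units.val_mul, diagonalGL_val, Matrix.mul_diagonal, Matrix.diagonal_mul] using this
  have hrow : ∀ i, ∃ j, g.val i j ≠ 0 := by
    intro i
    by_contra! h
    have := congrFun (congrFun g.mul_inv i) i
    simp [Matrix.mul_apply, h] at this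
  have hcol : ∀ j, ∃ i, g.val i j ≠ 0 := by
    intro j
    by_contra! h
    have := congrFun (congrFun g.inv_mul j) j
    simp [Matrix.mul_apply, h] at this
  have huniq : ∀ i j k, g.val i j ≠ 0 → g.val i k ≠ 0 → j = k := by
    intro i j k hj hk
    by_contra hjk
    -- The test matrix has 2 in slot k and 1 elsewhere: column j forces `e i = 1`, and column k then
    -- makes the entry equal to its double.
    obtain ⟨e, -, he⟩ := hconj (Pi.mulSingle k (Units.mk0 2 two_ne_zero))
    have h1 := he i j
    have h2 := he i k
    rw [Pi.mulSingle_eq_of_ne hjk, Units.val_one, mul_one] at h1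
    have h3 : (e i : A) = 1 := by
      apply mul_right_cancel₀ hj
      rw [one_mul, ← h1]
    rw [Pi.mulSingle_eq_same, h3, one_mul, Units.val_mk0, mul_two] at h2
    exact hk (by simpa using h2)
  choose τ hτ using hrow
  have hsurj : Function.Surjective τ := fun j => by
    obtain ⟨i, hi⟩ := hcol j
    exact ⟨i, huniq i _ _ (hτ i) hi⟩
  refine ⟨fun i => Units.mk0 _ (hτ i),
    (Equiv.ofBijective τ (Finite.surjective_iff_bijective.mp hsurj))⁻¹, fun d => ?_⟩
  obtain ⟨e, he, hent⟩ := hconj d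
  rw [he]
  congr 1
  ext1 i
  rw [eq_mul_inv_iff_mul_eq]
  apply Units.ext
  exact (hent i (τ i)).symm

end Monomial

/-! ### The correspondence with the semidirect product -/

section Action

variable {n : ℕ}

theorem quaternion_two_ne_zero : ((2 : ℝ) : ℍ[ℝ]) ≠ 0 := fun h => by
  simpa using congrArg (·.re) h

instance : NeZero (2 : ℍ[ℝ]) := ⟨quaternion_two_ne_zero⟩

/-- The automorphism `w` of the diagonal subgroup acts by the rotations and permutation of `a`. -/
def ActsAs (w : MulAut (diagonalSubgroup n ℍ[ℝ]))
    (a : (Fin n → Matrix.specialOrthogonalGroup (Fin 3) ℝ) ⋊[mulAutArrow]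
      Equiv.Perm (Fin n)) : Prop :=
  ∀ (h : diagonalSubgroup n ℍ[ℝ]) (i : Fin n),
    (w h).val.val i i = rotateIm (a.left i).val (h.val.val (a.right⁻¹ i) (a.right⁻¹ i))

theorem diagonalSubgroup_ext {h k : diagonalSubgroup n ℍ[ℝ]}
    (H : ∀ i, h.val.val i i = k.val.val i i) : h = k := by
  obtain ⟨_, d, rfl⟩ := h
  obtain ⟨_, e, rfl⟩ := k
  apply Subtype.ext
  change diagonalGL n _ d = diagonalGL n _ e
  congr 1
  ext1 i
  apply Units.ext
  simpa [diagonalGL_val] using H i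

variable {w w' : MulAut (diagonalSubgroup n ℍ[ℝ])}
  {a b : (Fin n → Matrix.specialOrthogonalGroup (Fin 3) ℝ) ⋊[mulAutArrow] Equiv.Perm (Fin n)}

theorem ActsAs.mul (hw : ActsAs w a) (hw' : ActsAs w' b) : ActsAs (w * w') (a * b) := by
  intro h i
  rw [MulAut.mul_apply, hw, hw', SemidirectProduct.mul_left, SemidirectProduct.mul_right,
    mul_inv_rev, ← rotateIm_mul]
  -- Under `mulAutArrow`, the translate of `b.left` by `a.right` has entry `b.left (a.right⁻¹ i)` at
  -- `i`.
  rfl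

theorem ActsAs.left_unique (hw : ActsAs w a) (hw' : ActsAs w' a) : w = w' :=
  MulEquiv.ext fun h => diagonalSubgroup_ext fun i => by rw [hw, hw']

/-- Constant tuples detect the rotations. A tuple with 2 in one slot and 1 elsewhere detects the
permutation, because rotations fix real parts. -/
theorem ActsAs.right_unique (ha : ActsAs w a) (hb : ActsAs w b) : a = b := by
  have key : ∀ (d : Fin n → ℍ[ℝ]ˣ) (i : Fin n),
      rotateIm (a.left i).val (d (a.right⁻¹ i)) = rotateIm (b.left i).val (d (b.right⁻¹ i)) := by
    intro d i
    have := (ha ⟨_, d, rfl⟩ i).symm.trans (hb ⟨_, d, rfl⟩ i)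
    simpa only [diagonalGL_val, Matrix.diagonal_apply_eq] using this
  apply SemidirectProduct.ext
  · ext1 i
    exact Subtype.ext (matrix_ext_of_rotateIm fun u => key (fun _ => u) i)
  · rw [← inv_inj]
    ext1 i
    by_contra hne
    have h := congrArg (·.re) (key (Pi.mulSingle (a.right⁻¹ i) (Units.mk0 _ quaternion_two_ne_zero)) i)
    rw [Pi.mulSingle_eq_same, Pi.mulSingle_eq_of_ne (Ne.symm hne)] at h
    simp [rotateIm] at h

theorem normalizer_actsAs {g : Subgroup.normalizer (diagonalSubgroup n ℍ[ℝ] : Set _)} {u : Fin n → ℍ[ℝ]ˣ}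
    (hg : ∀ d : Fin n → ℍ[ℝ]ˣ, g.val * diagonalGL n ℍ[ℝ] d * g.val⁻¹ =
      diagonalGL n ℍ[ℝ] fun i => u i * d (a.right⁻¹ i) * (u i)⁻¹)
    (hu : ∀ i x, rotateIm (a.left i).val x = u i * x * ((u i)⁻¹ : ℍ[ℝ]ˣ)) :
    ActsAs ((diagonalSubgroup n ℍ[ℝ]).normalizerMonoidHom g) a := by
  rintro ⟨_, d, rfl⟩ i
  rw [hu]
  have := congrArg (fun m => m.val i i) (hg d)
  simp only [diagonalGL_val, Matrix.diagonal_apply_eq, Units.val_mul] at this ⊢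
  exact this

theorem exists_actsAs_of_mem (hw : w ∈ weylGroupGL n ℍ[ℝ]) : ∃ a, ActsAs w a := by
  obtain ⟨g, rfl⟩ := hw
  obtain ⟨u, σ, hg⟩ := exists_perm_conj_of_mem_normalizer g.2
  choose R hR using fun i => exists_rotateIm_eq_conj (u i)
  exact ⟨⟨R, σ⟩, normalizer_actsAs hg hR⟩

theorem exists_mem_actsAs
    (a : (Fin n → Matrix.specialOrthogonalGroup (Fin 3) ℝ) ⋊[mulAutArrow] Equiv.Perm (Fin n)) :
    ∃ w ∈ weylGroupGL n ℍ[ℝ], ActsAs w a := by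
  choose u hu using fun i => exists_conj_eq_rotateIm (a.left i)
  exact ⟨_, ⟨⟨_, monomialGL_mem_normalizer u a.right⟩, rfl⟩,
    normalizer_actsAs (fun d => mul_inv_eq_of_eq_mul (monomialGL_mul_diagonalGL u d _)) hu⟩

end Action

end WeylQuaternion

open WeylQuaternion in
theorem mainTheorem8 (l : ℕ) :
    ∃ Φ : weylGroupGL (l + 1) ℍ[ℝ] ≃*
        (Fin (l + 1) → Matrix.specialOrthogonalGroup (Fin 3) ℝ) ⋊[mulAutArrow]
          Equiv.Perm (Fin (l + 1)),
      ∀ (w : weylGroupGL (l + 1) ℍ[ℝ]) (h : diagonalSubgroup (l + 1) ℍ[ℝ]) (i : Fin (l + 1)),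
        ((w : MulAut (diagonalSubgroup (l + 1) ℍ[ℝ])) h).val.val i i =
          rotateIm ((Φ w).left i).val
            (h.val.val ((Φ w).right⁻¹ i) ((Φ w).right⁻¹ i)) := by
  -- The choice is forced by `ActsAs.right_unique`, hence multiplicative.
  choose f hf using fun w : weylGroupGL (l + 1) ℍ[ℝ] => exists_actsAs_of_mem w.2
  let F := MonoidHom.mk' f fun w w' => (hf (w * w')).right_unique ((hf w).mul (hf w'))
  refine ⟨MulEquiv.ofBijective F ⟨fun w w' hww => ?_, fun a => ?_⟩, hf⟩
  · have hww' : f w = f w' := hww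
    exact Subtype.ext ((hf w).left_unique (hww' ▸ hf w'))
  · obtain ⟨w, hw, ha⟩ := exists_mem_actsAs a
    exact ⟨⟨w, hw⟩, (hf ⟨w, hw⟩).right_unique ha⟩
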